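/- **Theorem.** Let $D\subset\mathbb R^d$, $d\ge 1$, be a bounded open set (for instance a bounded domain with smooth boundary; neither connectedness nor regularity of the boundary is needed). Write $H=L^2(D)$ with norm $\|\cdot\|$ and inner product $(\cdot,\cdot)$, $V=H_0^1(D)$ (the completion of $C_c^\infty(D)$ under the norm $(\int_D|\nabla u|^2dx)^{1/2}$), and let $V\subset H\subset V^*$ be the corresponding Gelfand triple. Let $\Delta:V\to V^*$ be the Dirichlet Laplacian, $\langle\Delta u,v\rangle=-\int_D\nabla u\cdot\nabla v\,dx$. Suppose that $\sigma:\mathbb R\to\mathbb R$ satisfies (H) there are constants $L_1,L_2>0$ such that for all $x,y\in\mathbb R$ $$|\sigma(x)-\sigma(y)|\le L_1|x-y|+L_2|x-y|\bigl(\log_+(|x|\vee|y|)\bigr)^{1/2},\qquad \log_+z:=\log(1\vee z).$$ Let $T>0$, $h\in L^2([0,T];\mathbb R)$ and $u_0\in H$. A solution of the skeleton equation is a function $u\in C([0,T];H)\cap L^2([0,T];V)$ with $u(0)=u_0$ such that, for every $t\in[0,T]$, $$u(t)=u_0+\int_0^t\Delta u(s)\,ds+\int_0^t u(s)\log|u(s)|\,ds+\int_0^t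 h(s)\,\sigma(u(s))\,ds\quad\text{in }V^*,$$ where the integrals are Bochner integrals in $V^*$, a function $g$ on $D$ is regarded as the element $v\mapsto\int_D g\,v\,dx$ of $V^*$, and $0\log 0:=0$. Then solutions are unique: if $u$ and $v$ are two solutions of the skeleton equation with the same $h$ and the same $u_0$, then $u(t)=v(t)$ for all $t\in[0,T]$. -/

import Mathlib

open MeasureTheory Set TopologicalSpace
open scoped Distributions Gradient

noncomputable section

namespace LogHeat

/-- The space `H = L²(D)`. -/
abbrev H {d : ℕ} (D : Opens (EuclideanSpace ℝ (Fin d))) : Type :=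
  Lp ℝ 2 (volume.restrict (D : Set (EuclideanSpace ℝ (Fin d))))

/-- The space `L²(D; ℝᵈ)`, in which gradients live. -/
abbrev HVec {d : ℕ} (D : Opens (EuclideanSpace ℝ (Fin d))) : Type :=
  Lp (EuclideanSpace ℝ (Fin d)) 2 (volume.restrict (D : Set (EuclideanSpace ℝ (Fin d))))

/-- The pairs `(φ, ∇φ)` in `L²(D) × L²(D; ℝᵈ)`, where `φ` is a smooth function with compact
support in `D`. -/
def testGraph {d : ℕ} (D : Opens (EuclideanSpace ℝ (Fin d))) :
    Submodule ℝ (WithLp 2 (H D × HVec D)) where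
  carrier := {p | ∃ φ : 𝓓(D, ℝ),
    (p.fst : EuclideanSpace ℝ (Fin d) → ℝ)
      =ᵐ[volume.restrict (D : Set (EuclideanSpace ℝ (Fin d)))] φ ∧
    (p.snd : EuclideanSpace ℝ (Fin d) → EuclideanSpace ℝ (Fin d))
      =ᵐ[volume.restrict (D : Set (EuclideanSpace ℝ (Fin d)))] (∇ φ)}
  zero_mem' := by
    refine ⟨0, ?_, ?_⟩
    · filter_upwards [Lp.coeFn_zero ℝ 2
        (volume.restrict (D : Set (EuclideanSpace ℝ (Fin d))))] with x hx
      simpa using hx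
    · filter_upwards [Lp.coeFn_zero (EuclideanSpace ℝ (Fin d)) 2
        (volume.restrict (D : Set (EuclideanSpace ℝ (Fin d))))] with x hx
      simpa [gradient] using hx
  add_mem' := by
    rintro p q ⟨φ, hφ, hφ'⟩ ⟨ψ, hψ, hψ'⟩
    refine ⟨φ + ψ, ?_, ?_⟩
    · filter_upwards [Lp.coeFn_add p.fst q.fst, hφ, hψ] with x hx h1 h2
      simp only [WithLp.add_fst, FunLike.coe_add, Pi.add_apply] at hx ⊢
      rw [hx, h1, h2]
    · filter_upwards [Lp.coeFn_add p.snd q.snd, hφ', hψ'] with x hx h1 h2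
      simp only [WithLp.add_snd, Pi.add_apply] at hx ⊢
      rw [hx, h1, h2, FunLike.coe_add]
      simp only [gradient]
      rw [fderiv_add (φ.contDiff.differentiable (by simp) x)
        (ψ.contDiff.differentiable (by simp) x), map_add]
  smul_mem' := by
    rintro c p ⟨φ, hφ, hφ'⟩
    refine ⟨c • φ, ?_, ?_⟩
    · filter_upwards [Lp.coeFn_smul c p.fst, hφ] with x hx h1
      simp only [WithLp.smul_fst, FunLike.coe_smul, Pi.smul_apply] at hx ⊢
      rw [hx, h1]
    · filter_upwards [Lp.coeFn_smul c p.snd, hφ'] with x hx h1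
      simp only [WithLp.smul_snd, Pi.smul_apply] at hx ⊢
      rw [hx, h1, FunLike.coe_smul]
      simp only [gradient]
      rw [fderiv_const_smul (φ.contDiff.differentiable (by simp) x), map_smulₛₗ]
      simp

/-- The Sobolev space `V = H₀¹(D)`: the completion of the smooth functions with compact support
in `D`, realised as the closure of the pairs `(φ, ∇φ)` in `L²(D) × L²(D; ℝᵈ)`. An element is a
pair `(u, ∇u)`. Its norm is the square root of `‖u‖² + ‖∇u‖²`, which on a bounded `D` is
equivalent to `‖∇u‖` by the Poincaré inequality, so that `V`, its dual, and `L²([0,T]; V)` are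
the same spaces as those formed with `‖∇u‖`. -/
def V {d : ℕ} (D : Opens (EuclideanSpace ℝ (Fin d))) : Type :=
  ↥(testGraph D).topologicalClosure

instance {d : ℕ} (D : Opens (EuclideanSpace ℝ (Fin d))) : NormedAddCommGroup (V D) :=
  inferInstanceAs (NormedAddCommGroup ↥(testGraph D).topologicalClosure)

instance {d : ℕ} (D : Opens (EuclideanSpace ℝ (Fin d))) : InnerProductSpace ℝ (V D) :=
  inferInstanceAs (InnerProductSpace ℝ ↥(testGraph D).topologicalClosure)

instance {d : ℕ} (D : Opens (EuclideanSpace ℝ (Fin d))) : CompleteSpace (V D) :=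
  inferInstanceAs (CompleteSpace ↥(testGraph D).topologicalClosure)

/-- The embedding of `V` into `H`, that is `(u, ∇u) ↦ u`. -/
def incl {d : ℕ} (D : Opens (EuclideanSpace ℝ (Fin d))) : V D →L[ℝ] H D :=
  (WithLp.fstL 2 ℝ (H D) (HVec D)).comp (testGraph D).topologicalClosure.subtypeL

/-- The weak gradient `V → L²(D; ℝᵈ)`, that is `(u, ∇u) ↦ ∇u`. -/
def grad {d : ℕ} (D : Opens (EuclideanSpace ℝ (Fin d))) : V D →L[ℝ] HVec D :=
  (WithLp.sndL 2 ℝ (H D) (HVec D)).comp (testGraph D).topologicalClosure.subtypeL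

/-- The embedding of `H` into `V*` in the Gelfand triple: `⟨u, v⟩ = (u, v)`. -/
def toVDual {d : ℕ} (D : Opens (EuclideanSpace ℝ (Fin d))) (u : H D) : StrongDual ℝ (V D) :=
  (innerSL ℝ u).comp (incl D)

/-- The Dirichlet Laplacian from `V` to `V*`: `⟨Δu, v⟩ = - ∫_D ∇u · ∇v dx`. -/
def laplacian {d : ℕ} (D : Opens (EuclideanSpace ℝ (Fin d))) (u : V D) : StrongDual ℝ (V D) :=
  -(innerSL ℝ (grad D u)).comp (grad D)

/-- The function `g` on `D`, regarded as an element of `V*`, is `F`: for every `v ∈ V` the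
function `g v` is integrable on `D` and `⟨F, v⟩ = ∫_D g v dx`. -/
def Represents {d : ℕ} (D : Opens (EuclideanSpace ℝ (Fin d)))
    (g : EuclideanSpace ℝ (Fin d) → ℝ) (F : StrongDual ℝ (V D)) : Prop :=
  ∀ v : V D,
    IntegrableOn (fun x => g x * (incl D v) x) (D : Set (EuclideanSpace ℝ (Fin d))) volume ∧
      F v = ∫ x in (D : Set (EuclideanSpace ℝ (Fin d))), g x * (incl D v) x

/-- The hypothesis on `σ`: there are positive constants `L₁`, `L₂` with
`|σ(x) - σ(y)| ≤ L₁ |x - y| + L₂ |x - y| (log₊ (|x| ∨ |y|))^{1/2}`, where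
`log₊ z = log (1 ∨ z)`. -/
def HypH (σ : ℝ → ℝ) : Prop :=
  ∃ L₁ L₂ : ℝ, 0 < L₁ ∧ 0 < L₂ ∧ ∀ x y : ℝ,
    |σ x - σ y| ≤ L₁ * |x - y| + L₂ * |x - y| * √(Real.log (max 1 (max |x| |y|)))

/-- `u` (through its values on `[0,T]`) is a solution in `L²([0,T]; V) ∩ C([0,T]; H)` of
`u(t) = u₀ + ∫₀ᵗ Δu(s) ds + ∫₀ᵗ u(s) log|u(s)| ds + ∫₀ᵗ h(s) σ(u(s)) ds`, `t ∈ [0,T]`,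
an equation in `V*` with Bochner integrals. Here `w` is `u` seen as an element of
`L²([0,T]; V)`, while `F s` and `G s` are the functions `u(s) log|u(s)|` and `σ(u(s))` seen as
elements of `V*`. -/
structure IsSkeletonSolution {d : ℕ} (D : Opens (EuclideanSpace ℝ (Fin d))) (σ : ℝ → ℝ)
    (T : ℝ) (h : ℝ → ℝ) (u₀ : H D) (u : ℝ → H D) : Prop where
  continuousOn : ContinuousOn u (Icc 0 T)
  initial : u 0 = u₀
  equation : ∃ (w : ℝ → V D) (F G : ℝ → StrongDual ℝ (V D)),
    MemLp w 2 (volume.restrict (Icc 0 T)) ∧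
    (∀ᵐ s ∂(volume.restrict (Icc 0 T)), incl D (w s) = u s) ∧
    (∀ᵐ s ∂(volume.restrict (Icc 0 T)),
      Represents D (fun x => u s x * Real.log |u s x|) (F s)) ∧
    (∀ᵐ s ∂(volume.restrict (Icc 0 T)), Represents D (fun x => σ (u s x)) (G s)) ∧
    IntegrableOn F (Icc 0 T) volume ∧
    IntegrableOn (fun s => h s • G s) (Icc 0 T) volume ∧
    ∀ t ∈ Icc (0 : ℝ) T,
      toVDual D (u t) = toVDual D u₀ + (∫ s in (0 : ℝ)..t, laplacian D (w s))
        + (∫ s in (0 : ℝ)..t, F s) + ∫ s in (0 : ℝ)..t, h s • G s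

end LogHeat

end

open scoped ENNReal NNReal
open Filter Topology RealInnerProductSpace

/-! For the difference `z` of two solutions, the energy equality gives `‖z(t)‖² = 2 ∫₀ᵗ ⟨z', z⟩ ds`.
The Laplacian contributes `-2‖∇z‖²`. Pointwise, the logarithmic and `σ` terms are at most `3/2 z²ℓ²
+ (h²L²/2) z²` with `ℓ = 1 + log (1 ∨ (|u| + |v|))`; Young's inequality keeps the logarithm away
from `h`.

The crux is `∫ z²ℓ² ≤ 2‖z‖² + K ‖z‖ ‖∇z‖`, with `K` depending only on `D` and a bound for `‖u‖ +
‖v‖` (`exists_integral_incl_sq_mul_log_sq_le`). Since `ℓ²` is dominated by `2 + 2d² m^(2/d)` with `m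
= |u| + |v|`, Hölder with exponents `d/(d-1)` and `d` leaves the `L^(d/(d-1))` norm of `z²`, which
the `W^{1,1}` Sobolev inequality bounds by `‖∇(z²)‖₁ ≤ 2‖z‖‖∇z‖`. The gradient enters to first power
only, so it is absorbed by the Laplacian (`exists_two_mul_rate_sub_le`).

What remains is `‖z(t)‖² ≤ ∫₀ᵗ C(1 + h²)‖z‖² ds`, and linear Gronwall
(`eq_zero_of_le_intervalIntegral_mul`) gives `z = 0`. No logarithm of `‖z‖` appears. -/

/-! ### Weighted Sobolev inequality on smooth functions and on `H₀¹(D)`. -/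

theorem enorm_le_lintegral_enorm_fderiv_of_fin_one {g : EuclideanSpace ℝ (Fin 1) → ℝ}
    (hg : ContDiff ℝ 1 g) (hgc : HasCompactSupport g) (x : EuclideanSpace ℝ (Fin 1)) :
    ‖g x‖ₑ ≤ ∫⁻ y, ‖fderiv ℝ g y‖ₑ := by
  let e : ℝ ≃ₗᵢ[ℝ] EuclideanSpace ℝ (Fin 1) := (OrthonormalBasis.singleton (Fin 1) ℝ).repr
  have hd : ∀ t, ‖deriv (g ∘ e) t‖ₑ ≤ ‖fderiv ℝ g (e t)‖ₑ := by
    intro t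
    have h1 : HasDerivAt (g ∘ e) (fderiv ℝ g (e t) (e 1)) t := by
      have := (hg.differentiable (by simp) (e t)).hasFDerivAt.comp t
        (e : ℝ →L[ℝ] EuclideanSpace ℝ (Fin 1)).hasFDerivAt
      simpa using this.hasDerivAt
    rw [h1.deriv, enorm_le_iff_norm_le]
    simpa using (fderiv ℝ g (e t)).le_opNorm (e 1)
  have h2 := HasCompactSupport.enorm_le_lintegral_Ici_deriv (f := g ∘ e)
    (hg.comp e.contDiff) (hgc.comp_homeomorph e.toHomeomorph) (e.symm x)
  calc ‖g x‖ₑ = ‖(g ∘ e) (e.symm x)‖ₑ := by simp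
    _ ≤ ∫⁻ y in Iic (e.symm x), ‖deriv (g ∘ e) y‖ₑ := h2
    _ ≤ ∫⁻ y, ‖deriv (g ∘ e) y‖ₑ := setLIntegral_le_lintegral _ _
    _ ≤ ∫⁻ y, ‖fderiv ℝ g (e y)‖ₑ := lintegral_mono hd
    _ = ∫⁻ y, ‖fderiv ℝ g y‖ₑ :=
      e.measurePreserving.lintegral_comp_emb e.toMeasurableEquiv.measurableEmbedding
        (fun y => ‖fderiv ℝ g y‖ₑ)

/-- For `d > 1` this is Hölder with exponents `d/(d-1)` and `d` followed by
Gagliardo–Nirenberg–Sobolev. For `d = 1` the conjugate exponent is infinite, and the sup bound by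
the total variation takes over. -/
theorem exists_lintegral_enorm_mul_rpow_le {d : ℕ} (hd : 0 < d) :
    ∃ C : ℝ≥0, ∀ g : EuclideanSpace ℝ (Fin d) → ℝ, ContDiff ℝ 1 g → HasCompactSupport g →
      ∀ n : EuclideanSpace ℝ (Fin d) → ℝ≥0∞, AEMeasurable n →
        ∫⁻ x, ‖g x‖ₑ * n x ^ (1 / d : ℝ) ≤
          C * (∫⁻ x, ‖fderiv ℝ g x‖ₑ) * (∫⁻ x, n x) ^ (1 / d : ℝ) := by
  rcases Nat.lt_or_ge 1 d with h1 | h1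
  · have hd1 : (1 : ℝ) < d := by exact_mod_cast h1
    have hp : Real.HolderConjugate (d : ℝ) (Real.conjExponent d) := .conjExponent hd1
    set p := Real.conjExponent d
    have hp' : Real.HolderConjugate
        (Module.finrank ℝ (EuclideanSpace ℝ (Fin d)) : ℝ) p := by simpa using hp
    refine ⟨lintegralPowLePowLIntegralFDerivConst
      (volume : Measure (EuclideanSpace ℝ (Fin d))) p ^ (1 / p), fun g hg hgc n hn => ?_⟩
    have h3 := lintegral_pow_le_pow_lintegral_fderiv volume hg hgc hp'
    have hp0 : 0 < p := hp.symm.pos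
    calc ∫⁻ x, ‖g x‖ₑ * n x ^ (1 / d : ℝ)
        ≤ (∫⁻ x, ‖g x‖ₑ ^ p) ^ (1 / p) * (∫⁻ x, (n x ^ (1 / d : ℝ)) ^ (d : ℝ)) ^ (1 / d : ℝ) :=
          ENNReal.lintegral_mul_le_Lp_mul_Lq volume hp.symm
            hg.continuous.enorm.measurable.aemeasurable (hn.pow_const _)
      _ ≤ _ := by
        gcongr
        · calc (∫⁻ x, ‖g x‖ₑ ^ p) ^ (1 / p) ≤ _ := ENNReal.rpow_le_rpow h3 (by positivity)
            _ = _ := by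
              rw [ENNReal.mul_rpow_of_nonneg _ _ (by positivity), ← ENNReal.rpow_mul,
                mul_one_div_cancel hp0.ne', ENNReal.rpow_one,
                ENNReal.coe_rpow_of_nonneg _ (by positivity)]
        · rw [← ENNReal.rpow_mul, one_div_mul_cancel (by positivity), ENNReal.rpow_one]
  · obtain rfl : d = 1 := by omega
    refine ⟨1, fun g hg hgc n hn => ?_⟩
    simp only [Nat.cast_one, div_one, ENNReal.rpow_one, ENNReal.coe_one, one_mul]
    rw [← lintegral_const_mul'' _ hn]
    gcongr with x
    exact enorm_le_lintegral_enorm_fderiv_of_fin_one hg hgc x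

/-- The previous bound is applied to `φ²`; Cauchy–Schwarz on `|∇(φ²)| = 2|φ||∇φ|` yields the product
of norms. -/
theorem exists_lintegral_sq_mul_rpow_le {d : ℕ} (hd : 0 < d) :
    ∃ C : ℝ≥0, ∀ φ : EuclideanSpace ℝ (Fin d) → ℝ, ContDiff ℝ 1 φ → HasCompactSupport φ →
      ∀ n : EuclideanSpace ℝ (Fin d) → ℝ≥0∞, AEMeasurable n →
        ∫⁻ x, ‖φ x‖ₑ ^ 2 * n x ^ (1 / d : ℝ) ≤
          C * (eLpNorm φ 2 volume * eLpNorm (∇ φ) 2 volume) * (∫⁻ x, n x) ^ (1 / d : ℝ) := by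
  obtain ⟨C, hC⟩ := exists_lintegral_enorm_mul_rpow_le hd
  refine ⟨C * 2, fun φ hφ hφc n hn => ?_⟩
  have h1 := hC (fun x => φ x ^ 2) (hφ.pow 2) (hφc.comp_left (g := fun y : ℝ => y ^ 2) (by simp)) n hn
  have h2 : ∀ x, ‖fderiv ℝ (fun x => φ x ^ 2) x‖ₑ = 2 * (‖φ x‖ₑ * ‖∇ φ x‖ₑ) := by
    intro x
    have := ((hφ.differentiable (by simp) x).hasFDerivAt.pow 2).fderiv
    rw [this]
    simp only [gradient, LinearIsometryEquiv.enorm_map, enorm_smul, Nat.cast_ofNat, nsmul_eq_mul]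
    simp [mul_assoc, Real.enorm_eq_ofReal (zero_le_two (α := ℝ))]
  have hgm : AEMeasurable (fun x => ‖∇ φ x‖ₑ) := by
    have : Continuous (fun x => ∇ φ x) :=
      (LinearIsometryEquiv.continuous _).comp (hφ.continuous_fderiv (by simp))
    exact this.enorm.measurable.aemeasurable
  have h3 : ∫⁻ x, ‖φ x‖ₑ * ‖∇ φ x‖ₑ ≤ eLpNorm φ 2 volume * eLpNorm (∇ φ) 2 volume := by
    have := ENNReal.lintegral_mul_le_Lp_mul_Lq volume (p := 2) (q := 2) .two_two
      hφ.continuous.enorm.measurable.aemeasurable hgm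
    simpa [eLpNorm_eq_lintegral_rpow_enorm_toReal] using this
  simp only [h2, enorm_pow] at h1
  refine h1.trans ?_
  rw [lintegral_const_mul' _ _ (by simp)]
  push_cast
  rw [mul_assoc (C : ℝ≥0∞) 2]
  gcongr

namespace LogHeat

variable {d : ℕ} {D : Opens (EuclideanSpace ℝ (Fin d))}

theorem exists_lintegral_sq_mul_rpow_le_of_mem_testGraph (hd : 0 < d)
    (D : Opens (EuclideanSpace ℝ (Fin d))) :
    ∃ C : ℝ≥0, ∀ p ∈ testGraph D, ∀ n : EuclideanSpace ℝ (Fin d) → ℝ≥0∞,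
      AEMeasurable n (volume.restrict (D : Set (EuclideanSpace ℝ (Fin d)))) →
        ∫⁻ x in (D : Set (EuclideanSpace ℝ (Fin d))), ‖p.fst x‖ₑ ^ 2 * n x ^ (1 / d : ℝ) ≤
          C * (‖p.fst‖ₑ * ‖p.snd‖ₑ) *
            (∫⁻ x in (D : Set (EuclideanSpace ℝ (Fin d))), n x) ^ (1 / d : ℝ) := by
  obtain ⟨C, hC⟩ := exists_lintegral_sq_mul_rpow_le hd
  refine ⟨C, fun p ⟨φ, hφ1, hφ2⟩ n hn => ?_⟩
  have hDm : MeasurableSet (D : Set (EuclideanSpace ℝ (Fin d))) := D.isOpen.measurableSet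
  have hs2 : Function.support (∇ φ) ⊆ (D : Set (EuclideanSpace ℝ (Fin d))) := by
    refine subset_trans (fun x hx => ?_) φ.tsupport_subset
    refine support_fderiv_subset ℝ (f := φ) fun h0 => hx ?_
    simp [gradient, h0]
  have h1 := hC φ (φ.contDiff.of_le (by simp)) φ.hasCompactSupport
    -- The weight is extended by zero outside `D`.
    ((D : Set (EuclideanSpace ℝ (Fin d))).indicator n)
    ((aemeasurable_indicator_iff hDm).2 hn)
  rw [lintegral_indicator hDm, ← eLpNorm_restrict_eq_of_support_subset
    ((subset_tsupport φ).trans φ.tsupport_subset), ← eLpNorm_restrict_eq_of_support_subset hs2,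
    ← eLpNorm_congr_ae hφ1, ← eLpNorm_congr_ae hφ2, ← Lp.enorm_def, ← Lp.enorm_def] at h1
  refine le_trans ?_ h1
  refine le_trans (le_of_eq ?_) (setLIntegral_le_lintegral D _)
  refine lintegral_congr_ae ?_
  filter_upwards [hφ1, ae_restrict_mem hDm] with x hx hxD
  rw [hx, indicator_of_mem hxD]

theorem norm_incl_sq_add (v : V D) : ‖incl D v‖ ^ 2 + ‖grad D v‖ ^ 2 = ‖v‖ ^ 2 :=
  (WithLp.prod_norm_sq_eq_of_L2 v.1).symm

/-- Density of test functions: along an a.e. convergent subsequence Fatou handles the left side, and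
both norms on the right converge. Finiteness of `∫ n` avoids products `0 · ∞` in the limits. -/
theorem exists_lintegral_incl_sq_mul_rpow_le (hd : 0 < d)
    (D : Opens (EuclideanSpace ℝ (Fin d))) :
    ∃ C : ℝ≥0, ∀ v : V D, ∀ n : EuclideanSpace ℝ (Fin d) → ℝ≥0∞,
      AEMeasurable n (volume.restrict (D : Set (EuclideanSpace ℝ (Fin d)))) →
      ∫⁻ x in (D : Set (EuclideanSpace ℝ (Fin d))), n x ≠ ∞ →
        ∫⁻ x in (D : Set (EuclideanSpace ℝ (Fin d))), ‖incl D v x‖ₑ ^ 2 * n x ^ (1 / d : ℝ) ≤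
          C * (‖incl D v‖ₑ * ‖grad D v‖ₑ) *
            (∫⁻ x in (D : Set (EuclideanSpace ℝ (Fin d))), n x) ^ (1 / d : ℝ) := by
  obtain ⟨C, hC⟩ := exists_lintegral_sq_mul_rpow_le_of_mem_testGraph hd D
  refine ⟨C, fun v n hn hn' => ?_⟩
  obtain ⟨p, hp, hpv⟩ := mem_closure_iff_seq_limit.1 v.2
  have h1 : Filter.Tendsto (fun k => (p k).fst) Filter.atTop (nhds (incl D v)) :=
    ((WithLp.fstL 2 ℝ (H D) (HVec D)).continuous.tendsto v.1).comp hpv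
  have h2 : Filter.Tendsto (fun k => (p k).snd) Filter.atTop (nhds (grad D v)) :=
    ((WithLp.sndL 2 ℝ (H D) (HVec D)).continuous.tendsto v.1).comp hpv
  obtain ⟨ns, hns, hae⟩ := (tendstoInMeasure_of_tendsto_Lp h1).exists_seq_tendsto_ae
  set m := (∫⁻ x in (D : Set (EuclideanSpace ℝ (Fin d))), n x) ^ (1 / d : ℝ)
  have hm : m ≠ ∞ := ENNReal.rpow_ne_top_of_nonneg (by positivity) hn'
  have h3 : Filter.Tendsto (fun k => C * (‖(p (ns k)).fst‖ₑ * ‖(p (ns k)).snd‖ₑ) * m)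
      Filter.atTop (nhds (C * (‖incl D v‖ₑ * ‖grad D v‖ₑ) * m)) := by
    refine ENNReal.Tendsto.mul_const (ENNReal.Tendsto.const_mul (ENNReal.Tendsto.mul
      ((h1.comp hns.tendsto_atTop).enorm) (by simp) ((h2.comp hns.tendsto_atTop).enorm)
      (by simp)) (by simp)) (.inr hm)
  calc ∫⁻ x in (D : Set (EuclideanSpace ℝ (Fin d))), ‖incl D v x‖ₑ ^ 2 * n x ^ (1 / d : ℝ)
      = ∫⁻ x in (D : Set (EuclideanSpace ℝ (Fin d))), Filter.liminf (fun k =>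
          ‖(p (ns k)).fst x‖ₑ ^ 2 * n x ^ (1 / d : ℝ)) Filter.atTop := by
        refine lintegral_congr_ae ?_
        filter_upwards [hae, ae_lt_top' hn hn'] with x hx hnx
        refine (Filter.Tendsto.liminf_eq ?_).symm
        exact ENNReal.Tendsto.mul_const ((ENNReal.continuous_pow 2).continuousAt.tendsto.comp
          hx.enorm) (.inr (ENNReal.rpow_ne_top_of_nonneg (by positivity) hnx.ne))
    _ ≤ Filter.liminf (fun k => ∫⁻ x in (D : Set (EuclideanSpace ℝ (Fin d))),
          ‖(p (ns k)).fst x‖ₑ ^ 2 * n x ^ (1 / d : ℝ)) Filter.atTop :=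
        lintegral_liminf_le' fun k =>
          ((Lp.aestronglyMeasurable _).enorm.pow_const 2).fun_mul (hn.pow_const _)
    _ ≤ Filter.liminf (fun k => C * (‖(p (ns k)).fst‖ₑ * ‖(p (ns k)).snd‖ₑ) * m)
          Filter.atTop := by
        refine Filter.liminf_le_liminf (.of_forall fun k => hC _ (hp _) n hn)
    _ = _ := h3.liminf_eq

end LogHeat

/-! ### Absorbing the squared logarithmic weight. -/

theorem lintegral_enorm_sq_eq_enorm_sq {α E : Type*} [MeasurableSpace α] [NormedAddCommGroup E]
    {μ : Measure α} (f : Lp E 2 μ) : ∫⁻ x, ‖f x‖ₑ ^ 2 ∂μ = ‖f‖ₑ ^ 2 := by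
  rw [Lp.enorm_def, eLpNorm_eq_lintegral_rpow_enorm_toReal (by simp) (by simp),
    ← ENNReal.rpow_natCast, ← ENNReal.rpow_mul]
  simp

/-- From `log t ≤ d t^(1/d)`. The power is chosen so that the weight `n = m²` of the Sobolev bound
has integral `‖m‖²`. -/
theorem one_add_log_sq_le {d : ℕ} (hd : 0 < d) (x : ℝ) :
    (1 + Real.log (max 1 |x|)) ^ 2 ≤ 2 + 2 * d ^ 2 * (|x| ^ 2) ^ (1 / d : ℝ) := by
  have hd' : (0 : ℝ) < d := by exact_mod_cast hd
  have h0 : 0 ≤ Real.log (max 1 |x|) := Real.log_nonneg (le_max_left _ _)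
  have h1 : Real.log (max 1 |x|) ≤ d * |x| ^ (1 / d : ℝ) := by
    rcases le_total |x| 1 with h | h
    · rw [max_eq_left h, Real.log_one]; positivity
    · rw [max_eq_right h]
      have := Real.log_le_rpow_div (abs_nonneg x) (ε := 1 / d) (by positivity)
      rw [div_div_eq_mul_div, div_one] at this
      linarith
  have h2 : (|x| ^ 2) ^ (1 / d : ℝ) = (|x| ^ (1 / d : ℝ)) ^ 2 := by
    rw [← Real.rpow_natCast, ← Real.rpow_natCast, ← Real.rpow_mul (abs_nonneg x),
      ← Real.rpow_mul (abs_nonneg x), mul_comm]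
  rw [h2]
  have h3 : Real.log (max 1 |x|) ^ 2 ≤ (d * |x| ^ (1 / d : ℝ)) ^ 2 := by gcongr
  nlinarith [sq_nonneg (1 - Real.log (max 1 |x|))]

namespace LogHeat

variable {d : ℕ} {D : Opens (EuclideanSpace ℝ (Fin d))}

theorem exists_lintegral_incl_sq_mul_log_sq_le (hd : 0 < d)
    (D : Opens (EuclideanSpace ℝ (Fin d))) {R : ℝ} (hR : 0 ≤ R) :
    ∃ K : ℝ, 0 ≤ K ∧ ∀ (v : V D) (m : H D), ‖m‖ ≤ R →
      ∫⁻ x in (D : Set (EuclideanSpace ℝ (Fin d))),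
          ENNReal.ofReal (incl D v x ^ 2 * (1 + Real.log (max 1 |m x|)) ^ 2) ≤
        ENNReal.ofReal (2 * ‖incl D v‖ ^ 2 + K * (‖incl D v‖ * ‖grad D v‖)) := by
  obtain ⟨C, hC⟩ := exists_lintegral_incl_sq_mul_rpow_le hd D
  refine ⟨2 * d ^ 2 * C * (R ^ 2) ^ (1 / d : ℝ), by positivity, fun v m hm => ?_⟩
  have hmm : AEMeasurable (fun x => ‖m x‖ₑ ^ 2)
    (volume.restrict (D : Set (EuclideanSpace ℝ (Fin d)))) :=
    (Lp.aestronglyMeasurable m).enorm.pow_const 2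
  have h1 := hC v (fun x => ‖m x‖ₑ ^ 2) hmm
    (by rw [lintegral_enorm_sq_eq_enorm_sq]; simp)
  rw [lintegral_enorm_sq_eq_enorm_sq] at h1
  have key : ∀ x, ENNReal.ofReal (incl D v x ^ 2 * (1 + Real.log (max 1 |m x|)) ^ 2) ≤
      ENNReal.ofReal 2 * ‖incl D v x‖ₑ ^ 2 +
        ENNReal.ofReal (2 * d ^ 2) * (‖incl D v x‖ₑ ^ 2 * (‖m x‖ₑ ^ 2) ^ (1 / d : ℝ)) := by
    intro x
    have e1 : ‖incl D v x‖ₑ ^ 2 = ENNReal.ofReal (incl D v x ^ 2) := by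
      rw [← enorm_pow, Real.enorm_eq_ofReal (sq_nonneg _)]
    have e2 : (‖m x‖ₑ ^ 2) ^ (1 / d : ℝ) = ENNReal.ofReal ((|m x| ^ 2) ^ (1 / d : ℝ)) := by
      rw [← enorm_pow, Real.enorm_eq_ofReal (sq_nonneg _), sq_abs,
        ENNReal.ofReal_rpow_of_nonneg (sq_nonneg _) (by positivity)]
    rw [e1, e2, ← ENNReal.ofReal_mul (by positivity), ← ENNReal.ofReal_mul (by positivity),
      ← ENNReal.ofReal_mul (by positivity), ← ENNReal.ofReal_add (by positivity) (by positivity)]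
    refine ENNReal.ofReal_le_ofReal ?_
    have := mul_le_mul_of_nonneg_left (one_add_log_sq_le hd (m x)) (sq_nonneg (incl D v x))
    linarith
  refine (lintegral_mono key).trans ?_
  rw [lintegral_add_left' (((Lp.aestronglyMeasurable _).enorm.pow_const 2).const_mul _),
    lintegral_const_mul' _ _ ENNReal.ofReal_ne_top, lintegral_const_mul' _ _ ENNReal.ofReal_ne_top,
    lintegral_enorm_sq_eq_enorm_sq, ENNReal.ofReal_add (by positivity) (by positivity)]
  have e4 : ENNReal.ofReal 2 * ‖incl D v‖ₑ ^ 2 = ENNReal.ofReal (2 * ‖incl D v‖ ^ 2) := by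
    rw [ENNReal.ofReal_mul (by positivity), ENNReal.ofReal_pow (norm_nonneg _), ofReal_norm]
  have e5 : (‖m‖ₑ ^ 2) ^ (1 / d : ℝ) ≤ ENNReal.ofReal ((R ^ 2) ^ (1 / d : ℝ)) := by
    rw [← ENNReal.ofReal_rpow_of_nonneg (sq_nonneg _) (by positivity), ENNReal.ofReal_pow hR,
      ← ofReal_norm]
    gcongr
  rw [e4]
  gcongr
  refine (mul_le_mul' le_rfl (h1.trans (mul_le_mul' le_rfl e5))).trans (le_of_eq ?_)
  rw [← ofReal_norm, ← ofReal_norm, ← ENNReal.ofReal_coe_nnreal,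
    ← ENNReal.ofReal_mul (by positivity), ← ENNReal.ofReal_mul (by positivity),
    ← ENNReal.ofReal_mul (by positivity), ← ENNReal.ofReal_mul (by positivity)]
  congr 1
  ring

theorem exists_integral_incl_sq_mul_log_sq_le (hd : 0 < d)
    (D : Opens (EuclideanSpace ℝ (Fin d))) {R : ℝ} (hR : 0 ≤ R) :
    ∃ K : ℝ, 0 ≤ K ∧ ∀ (v : V D) (m : H D), ‖m‖ ≤ R →
      IntegrableOn (fun x => incl D v x ^ 2 * (1 + Real.log (max 1 |m x|)) ^ 2)
        (D : Set (EuclideanSpace ℝ (Fin d))) ∧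
      ∫ x in (D : Set (EuclideanSpace ℝ (Fin d))),
          incl D v x ^ 2 * (1 + Real.log (max 1 |m x|)) ^ 2 ≤
        2 * ‖incl D v‖ ^ 2 + K * (‖incl D v‖ * ‖grad D v‖) := by
  obtain ⟨K, hK0, hK⟩ := exists_lintegral_incl_sq_mul_log_sq_le hd D hR
  refine ⟨K, hK0, fun v m hm => ?_⟩
  have h1 := hK v m hm
  have hmeas : AEStronglyMeasurable
      (fun x => incl D v x ^ 2 * (1 + Real.log (max 1 |m x|)) ^ 2)
      (volume.restrict (D : Set (EuclideanSpace ℝ (Fin d)))) := by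
    have h2 : AEMeasurable (m : EuclideanSpace ℝ (Fin d) → ℝ)
      (volume.restrict (D : Set (EuclideanSpace ℝ (Fin d)))) :=
      (Lp.aestronglyMeasurable m).aemeasurable
    have h3 : AEMeasurable (incl D v : EuclideanSpace ℝ (Fin d) → ℝ)
      (volume.restrict (D : Set (EuclideanSpace ℝ (Fin d)))) :=
      (Lp.aestronglyMeasurable _).aemeasurable
    have h4 : Measurable (fun y : ℝ => (1 + Real.log (max 1 |y|)) ^ 2) := by fun_prop
    exact ((h3.pow_const 2).fun_mul (h4.comp_aemeasurable h2)).aestronglyMeasurable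
  have hnn : ∀ x, 0 ≤ incl D v x ^ 2 * (1 + Real.log (max 1 |m x|)) ^ 2 := fun x => by positivity
  refine ⟨⟨hmeas, ?_⟩, ?_⟩
  · rw [hasFiniteIntegral_iff_ofReal (.of_forall hnn)]
    exact h1.trans_lt ENNReal.ofReal_lt_top
  · rw [integral_eq_lintegral_of_nonneg_ae (.of_forall hnn) hmeas]
    exact ENNReal.toReal_le_of_le_ofReal (by positivity) h1

end LogHeat

/-! ### Energy equality through translations in time. -/

section Translation

variable {E : Type*} [NormedAddCommGroup E] [InnerProductSpace ℝ E]

/-- Translations act strongly continuously on `L²(ℝ; E)`, and the inner product of `L²(S; E)` is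
continuous. -/
theorem continuous_setIntegral_inner_translate {f g : ℝ → E} (hf : MemLp f 2 volume)
    (hg : MemLp g 2 volume) (S : Set ℝ) :
    Continuous fun p : ℝ × ℝ => ∫ t in S, ⟪f (p.1 + t), g (p.2 + t) + g t⟫ := by
  have : Fact ((2 : ℝ≥0∞) ≠ ∞) := ⟨by simp⟩
  let r := LpToLpRestrictCLM ℝ E ℝ volume 2 S
  have hc : Continuous fun p : ℝ × ℝ =>
      ⟪r (DomAddAct.mk p.1 +ᵥ hf.toLp f), r (DomAddAct.mk p.2 +ᵥ hg.toLp g) + r (hg.toLp g)⟫ := by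
    have h1 : ∀ F : Lp E 2 (volume : Measure ℝ),
        Continuous fun s : ℝ => DomAddAct.mk s +ᵥ F := fun F =>
      (continuous_id.vadd continuous_const).comp DomAddAct.mkHomeomorph.continuous
    exact (r.continuous.comp ((h1 _).comp continuous_fst)).inner
      ((r.continuous.comp ((h1 _).comp continuous_snd)).add continuous_const)
  refine hc.congr fun p => ?_
  rw [L2.inner_def]
  refine integral_congr_ae ?_
  have hshift : ∀ (s : ℝ) {k : ℝ → E} (hk : MemLp k 2 volume),
      r (DomAddAct.mk s +ᵥ hk.toLp k) =ᵐ[volume.restrict S] fun t => k (s + t) := by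
    intro s k hk
    refine (LpToLpRestrictCLM_coeFn ℝ S _).trans (ae_restrict_of_ae ?_)
    rw [DomAddAct.mk_vadd_toLp]
    exact MemLp.coeFn_toLp _
  filter_upwards [hshift p.1 hf, hshift p.2 hg, LpToLpRestrictCLM_coeFn ℝ S (hg.toLp g),
    ae_restrict_of_ae hg.coeFn_toLp, Lp.coeFn_add (r (DomAddAct.mk p.2 +ᵥ hg.toLp g))
      (r (hg.toLp g))] with t h1 h2 h3 h4 h5
  rw [h5, Pi.add_apply, h1, h2, h3, h4]

theorem memLp_comp_add_left {E : Type*} [NormedAddCommGroup E] {f : ℝ → E} (hf : MemLp f 2 volume) (s : ℝ) :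
    MemLp (fun t => f (s + t)) 2 volume :=
  hf.comp_measurePreserving (measurePreserving_add_left volume s)

theorem integrable_inner_of_memLp {α : Type*} [MeasurableSpace α] {μ : Measure α} {f g : α → E}
    (hf : MemLp f 2 μ) (hg : MemLp g 2 μ) : Integrable (fun x => ⟪f x, g x⟫) μ := by
  refine (L2.integrable_inner (𝕜 := ℝ) (hf.toLp f) (hg.toLp g)).congr ?_
  filter_upwards [hf.coeFn_toLp, hg.coeFn_toLp] with x h1 h2
  rw [h1, h2]

/-- For each shift, the integral of the absolute value is at most `‖f‖² + ‖g‖²` by Young and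
translation invariance; this constant is integrable over the finite-measure set `S`. -/
theorem integrable_prod_inner_translate {f g : ℝ → E} (hf : MemLp f 2 volume)
    (hg : MemLp g 2 volume) {S : Set ℝ} (hS : volume S ≠ ∞) (S' : Set ℝ) :
    Integrable (fun p : ℝ × ℝ => ⟪f (p.1 + p.2), g p.2⟫)
      ((volume.restrict S).prod (volume.restrict S')) := by
  have : IsFiniteMeasure (volume.restrict S) := ⟨by simpa using hS.lt_top⟩
  have hm : AEStronglyMeasurable (fun p : ℝ × ℝ => ⟪f (p.1 + p.2), g p.2⟫)
      (volume.prod volume) :=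
    (hf.1.comp_quasiMeasurePreserving (quasiMeasurePreserving_add volume volume)).inner hg.1.comp_snd
  have hm' : AEStronglyMeasurable (fun p : ℝ × ℝ => ⟪f (p.1 + p.2), g p.2⟫)
      ((volume.restrict S).prod (volume.restrict S')) := by
    rw [Measure.prod_restrict]; exact hm.restrict
  have hf2 := (memLp_two_iff_integrable_sq_norm hf.1).1 hf
  have hg2 := (memLp_two_iff_integrable_sq_norm hg.1).1 hg
  refine (integrable_prod_iff hm').2 ⟨.of_forall fun s =>
    (integrable_inner_of_memLp (memLp_comp_add_left hf s) hg).restrict, ?_⟩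
  refine Integrable.mono' (integrable_const ((∫ t, ‖f t‖ ^ 2) + ∫ t, ‖g t‖ ^ 2))
    hm'.norm.integral_prod_right' (.of_forall fun s => ?_)
  rw [Real.norm_of_nonneg (integral_nonneg fun _ => norm_nonneg _)]
  have hfs : Integrable (fun t => ‖f (s + t)‖ ^ 2) := hf2.comp_add_left s
  calc ∫ t in S', ‖⟪f (s + t), g t⟫‖
      ≤ ∫ t in S', (‖f (s + t)‖ ^ 2 + ‖g t‖ ^ 2) := by
        refine integral_mono (integrable_inner_of_memLp (memLp_comp_add_left hf s)
          hg).norm.restrict (hfs.add hg2).restrict fun t => ?_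
        refine (norm_inner_le_norm (𝕜 := ℝ) _ _).trans ?_
        nlinarith [sq_nonneg (‖f (s + t)‖ - ‖g t‖), sq_nonneg ‖f (s + t)‖, sq_nonneg ‖g t‖]
    _ ≤ ∫ t, (‖f (s + t)‖ ^ 2 + ‖g t‖ ^ 2) :=
        setIntegral_le_integral (hfs.add hg2) (.of_forall fun t => by positivity)
    _ = (∫ t, ‖f t‖ ^ 2) + ∫ t, ‖g t‖ ^ 2 := by
        rw [integral_add hfs hg2, integral_add_left_eq_self (fun t => ‖f t‖ ^ 2) s]

theorem intervalIntegral_swap_inner_translate {f g : ℝ → E} (hf : MemLp f 2 volume)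
    (hg : MemLp g 2 volume) {k τ : ℝ} (hk : 0 ≤ k) (hτ : 0 ≤ τ) :
    ∫ t in 0..τ, ∫ s in 0..k, ⟪f (s + t), g t⟫ = ∫ s in 0..k, ∫ t in Ioc 0 τ, ⟪f (s + t), g t⟫ := by
  simp only [intervalIntegral.integral_of_le hk, intervalIntegral.integral_of_le hτ]
  exact (integral_integral_swap (f := fun s t => ⟪f (s + t), g t⟫)
    (integrable_prod_inner_translate hf hg (by simp) _)).symm

end Translation

theorem tendsto_inv_mul_intervalIntegral {F : ℝ × ℝ → ℝ} (hF : Continuous F) :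
    Tendsto (fun k : ℝ => k⁻¹ * ∫ s in 0..k, F (s, k)) (𝓝[>] 0) (𝓝 (F (0, 0))) := by
  rw [Metric.tendsto_nhdsWithin_nhds]
  intro ε hε
  obtain ⟨δ, hδ, hδF⟩ := Metric.continuousAt_iff.1 (hF.continuousAt (x := (0, 0))) (ε / 2)
    (half_pos hε)
  refine ⟨δ, hδ, fun {k} hk hkδ => ?_⟩
  have hk0 : 0 < k := hk
  have hkδ' : k < δ := by simpa [abs_of_pos hk0] using hkδ
  have h1 : ‖∫ s in 0..k, (F (s, k) - F (0, 0))‖ ≤ ε / 2 * |k - 0| := by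
    refine intervalIntegral.norm_integral_le_of_norm_le_const fun s hs => ?_
    rw [uIoc_of_le hk0.le] at hs
    refine (hδF (x := (s, k)) ?_).le
    rw [Prod.dist_eq]
    refine max_lt ?_ ?_ <;> simp only [Real.dist_eq, sub_zero]
    · rw [abs_of_pos hs.1]; exact hs.2.trans_lt hkδ'
    · rw [abs_of_pos hk0]; exact hkδ'
  have hFk : Continuous fun s => F (s, k) := hF.comp (by fun_prop)
  rw [intervalIntegral.integral_sub (hFk.intervalIntegrable _ _) (by simp), intervalIntegral.integral_const, sub_zero, smul_eq_mul, abs_of_pos hk0,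
    Real.norm_eq_abs] at h1
  rw [Real.dist_eq]
  have h2 : k⁻¹ * (∫ s in 0..k, F (s, k)) - F (0, 0) =
      k⁻¹ * ((∫ s in 0..k, F (s, k)) - k * F (0, 0)) := by field_simp
  rw [h2, abs_mul, abs_of_pos (inv_pos.2 hk0)]
  calc k⁻¹ * |(∫ s in 0..k, F (s, k)) - k * F (0, 0)| ≤ k⁻¹ * (ε / 2 * k) := by gcongr
    _ = ε / 2 := by field_simp
    _ < ε := half_lt_self hε

/-- The integral equals `∫ φ` over `[τ, τ+k]` minus `∫ φ` over `[0, k]`, so the quotient is a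
difference quotient of a primitive. -/
theorem tendsto_inv_mul_intervalIntegral_translate_sub {φ : ℝ → ℝ} (hφ : Continuous φ) (τ : ℝ) :
    Tendsto (fun k : ℝ => k⁻¹ * ∫ t in 0..τ, (φ (k + t) - φ t)) (𝓝[>] 0) (𝓝 (φ τ - φ 0)) := by
  have hi : ∀ a b, IntervalIntegrable φ volume a b := fun a b => hφ.intervalIntegrable a b
  have hP : ∀ x, HasDerivAt (fun x => ∫ t in 0..x, φ t) (φ x) x := fun x =>
    intervalIntegral.integral_hasDerivAt_right (hi _ _)
      (hφ.stronglyMeasurableAtFilter _ _) hφ.continuousAt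
  have h1 : HasDerivAt (fun k : ℝ => (∫ t in 0..(k + τ), φ t) - ∫ t in 0..k, φ t)
      (φ τ - φ 0) 0 := by
    have := (hP (0 + τ)).comp_add_const 0 τ
    rw [zero_add] at this
    exact this.sub (hP 0)
  have h2 := (hasDerivAt_iff_tendsto_slope_zero.1 h1).mono_left
    (nhdsWithin_mono (0 : ℝ) (s := Ioi 0) (t := {0}ᶜ) (fun x hx => (ne_of_gt hx : x ≠ 0)))
  refine h2.congr fun k => ?_
  have hφk : Continuous fun t => φ (k + t) := hφ.comp (by fun_prop)
  rw [intervalIntegral.integral_sub (hφk.intervalIntegrable _ _) (hi _ _),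
    intervalIntegral.integral_comp_add_left, add_zero, smul_eq_mul]
  simp only [zero_add, intervalIntegral.integral_same, sub_zero]
  rw [← intervalIntegral.integral_add_adjacent_intervals (hi 0 k) (hi k (k + τ))]
  ring_nf

section EnergyEquality

variable {V H : Type*} [NormedAddCommGroup V] [InnerProductSpace ℝ V]
  [NormedAddCommGroup H] [InnerProductSpace ℝ H]

/-- No mollification is needed: `‖u(t+k)‖² - ‖u(t)‖² = ⟪u(t+k) - u(t), u(t+k) + u(t)⟫`, and for a.e.
`t` the sum lies in `V`, so the equation can be tested with it. Integrating over `t`, exchanging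
integrals, dividing by `k` and letting `k → 0` gives the identity. Having `τ < T` leaves room for
the shift. -/
theorem norm_sq_eq_two_mul_integral_inner (ι : V →L[ℝ] H) {T : ℝ} {u : ℝ → H}
    (hu : ContinuousOn u (Icc 0 T)) (hu0 : u 0 = 0) {w ψ : ℝ → V}
    (hw : MemLp w 2 (volume.restrict (Icc 0 T))) (hψ : MemLp ψ 2 (volume.restrict (Icc 0 T)))
    (hwu : ∀ᵐ s ∂(volume.restrict (Icc 0 T)), ι (w s) = u s)
    (heq : ∀ t ∈ Icc 0 T, ∀ x, ⟪u t, ι x⟫ = ∫ s in 0..t, ⟪ψ s, x⟫) {τ : ℝ} (hτ : τ ∈ Ico 0 T) :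
    ‖u τ‖ ^ 2 = 2 * ∫ s in 0..τ, ⟪ψ s, w s⟫ := by
  have hT : 0 ≤ T := hτ.1.trans hτ.2.le
  set f := (Icc 0 T).indicator ψ with hf_def
  set g := (Icc 0 T).indicator w with hg_def
  have hf : MemLp f 2 volume := (memLp_indicator_iff_restrict measurableSet_Icc).2 hψ
  have hg : MemLp g 2 volume := (memLp_indicator_iff_restrict measurableSet_Icc).2 hw
  have hfi : ∀ (x : V) (a b : ℝ), IntervalIntegrable (fun s => ⟪f s, x⟫) volume a b := by
    intro x a b
    have : IsFiniteMeasure (volume.restrict (uIoc a b)) := by rw [uIoc]; infer_instance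
    exact intervalIntegrable_iff.2 ((hf.restrict _).inner_const x |>.integrable (by simp))
  have heq' : ∀ t ∈ Icc 0 T, ∀ x, ⟪u t, ι x⟫ = ∫ s in 0..t, ⟪f s, x⟫ := by
    intro t ht x
    rw [heq t ht x]
    refine intervalIntegral.integral_congr fun s hs => ?_
    rw [uIcc_of_le ht.1] at hs
    simp only [hf_def, indicator_of_mem (show s ∈ Icc 0 T from ⟨hs.1, hs.2.trans ht.2⟩)]
  have hgu : ∀ᵐ s, s ∈ Icc 0 T → ι (g s) = u s := by
    filter_upwards [(ae_restrict_iff' measurableSet_Icc).1 hwu] with s hs hsT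
    rw [hg_def, indicator_of_mem hsT, hs hsT]
  set φ : ℝ → ℝ := IccExtend hT ((Icc 0 T).domRestrict fun t => ‖u t‖ ^ 2) with hφ_def
  have hφ : Continuous φ :=
    (continuousOn_iff_continuous_domRestrict.1 (hu.norm.pow 2)).Icc_extend'
  have hφu : ∀ t ∈ Icc 0 T, φ t = ‖u t‖ ^ 2 := fun t ht => by
    rw [hφ_def, IccExtend_of_mem _ _ ht, domRestrict_apply]
  set F : ℝ × ℝ → ℝ := fun p => ∫ t in Ioc 0 τ, ⟪f (p.1 + t), g (p.2 + t) + g t⟫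
  have hF : Continuous F := continuous_setIntegral_inner_translate hf hg _
  have hincr : ∀ k ∈ Ioo 0 (T - τ),
      ∫ t in 0..τ, (φ (k + t) - φ t) = ∫ s in 0..k, F (s, k) := by
    intro k hk
    have hgk : MemLp (fun t => g (k + t) + g t) 2 volume := (memLp_comp_add_left hg k).add hg
    refine Eq.trans ?_ (intervalIntegral_swap_inner_translate hf hgk hk.1.le hτ.1)
    refine intervalIntegral.integral_congr_ae ?_
    filter_upwards [hgu, (measurePreserving_add_left volume k).quasiMeasurePreserving.ae hgu]
      with t h1 h2 ht
    rw [uIoc_of_le hτ.1] at ht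
    have ht1 : t ∈ Icc 0 T := ⟨ht.1.le, ht.2.trans hτ.2.le⟩
    have ht2 : k + t ∈ Icc 0 T := ⟨by linarith [ht.1, hk.1], by linarith [ht.2, hk.2]⟩
    -- This vector of `V` does not depend on the integration variable `s` below.
    set x := g (k + t) + g t
    have hx : ι x = u (k + t) + u t := by rw [map_add, h1 ht1, h2 ht2]
    calc φ (k + t) - φ t = ⟪u (k + t), ι x⟫ - ⟪u t, ι x⟫ := by
          rw [hφu _ ht1, hφu _ ht2, hx, inner_add_right, inner_add_right,
            real_inner_self_eq_norm_sq, real_inner_self_eq_norm_sq, real_inner_comm (u (k + t))]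
          ring
      _ = ∫ s in t..(k + t), ⟪f s, x⟫ := by
          rw [heq' _ ht1, heq' _ ht2,
            intervalIntegral.integral_interval_sub_left (hfi _ _ _) (hfi _ _ _)]
      _ = ∫ s in 0..k, ⟪f (s + t), x⟫ := by
          rw [intervalIntegral.integral_comp_add_right (fun s => ⟪f s, x⟫), zero_add]
  have hlim := (tendsto_inv_mul_intervalIntegral_translate_sub hφ τ).congr' (f₂ := fun k =>
      k⁻¹ * ∫ s in 0..k, F (s, k)) (by
    filter_upwards [Ioo_mem_nhdsGT (sub_pos.2 hτ.2)] with k hk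
    rw [hincr k hk])
  have h1 := tendsto_nhds_unique hlim (tendsto_inv_mul_intervalIntegral hF)
  rw [hφu τ ⟨hτ.1, hτ.2.le⟩, hφu 0 ⟨le_rfl, hT⟩, hu0, norm_zero] at h1
  rw [show ‖u τ‖ ^ 2 = F (0, 0) by linarith, intervalIntegral.integral_of_le hτ.1,
    ← integral_const_mul]
  refine setIntegral_congr_fun measurableSet_Ioc fun t ht => ?_
  have ht1 : t ∈ Icc 0 T := ⟨ht.1.le, ht.2.trans hτ.2.le⟩
  simp only [zero_add, hf_def, hg_def, indicator_of_mem ht1, inner_add_right]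
  ring

end EnergyEquality

/-! ### Gronwall's lemma with an integrable coefficient. -/

theorem eq_zero_of_le_intervalIntegral_mul {φ a : ℝ → ℝ} {T : ℝ} (hT : 0 < T)
    (hφ : ContinuousOn φ (Icc 0 T)) (hφ0 : ∀ t ∈ Icc 0 T, 0 ≤ φ t)
    (ha : IntegrableOn a (Icc 0 T)) (ha0 : ∀ s, 0 ≤ a s)
    (h : ∀ t ∈ Ico 0 T, φ t ≤ ∫ s in 0..t, a s * φ s) : ∀ t ∈ Icc 0 T, φ t = 0 := by
  have hai : ∀ b ∈ Icc 0 T, ∀ c ∈ Icc 0 T, IntervalIntegrable a volume b c := fun b hb c hc =>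
    intervalIntegrable_iff.2 (ha.mono_set
      ((uIoc_subset_uIcc).trans (uIcc_subset_Icc hb hc)))
  have haφ : ∀ b ∈ Icc 0 T, ∀ c ∈ Icc 0 T,
      IntervalIntegrable (fun s => a s * φ s) volume b c := fun b hb c hc =>
    (hai b hb c hc).mul_continuousOn (hφ.mono (uIcc_subset_Icc hb hc))
  have hA : UniformContinuousOn (fun t => ∫ s in 0..t, a s) (Icc 0 T) :=
    isCompact_Icc.uniformContinuousOn_of_continuous
      (by
        have := intervalIntegral.continuousOn_primitive_interval (μ := volume) (f := a) (a := 0)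
          (b := T) (by rwa [uIcc_of_le hT.le])
        rwa [uIcc_of_le hT.le] at this)
  -- On windows shorter than `δ` the integral of `a` is below `1/2`. The induction advances by `δ/2`
  -- to keep the inequality strict.
  obtain ⟨δ, hδ, hδA⟩ := Metric.uniformContinuousOn_iff.1 hA (1 / 2) (by norm_num)
  have key : ∀ n : ℕ, ∀ t ∈ Ico 0 T, t ≤ n * (δ / 2) → φ t = 0 := by
    intro n
    induction n with
    | zero =>
      intro t ht htn
      obtain rfl : t = 0 := le_antisymm (by simpa using htn) ht.1
      refine le_antisymm ?_ (hφ0 0 ⟨le_rfl, hT.le⟩)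
      simpa using h 0 ht
    | succ n ih =>
      intro t ht htn
      -- At a maximum point `r` beyond the region already settled, the hypothesis yields `φ r ≤
      -- (1/2) φ r`.
      obtain ⟨r, hr, hrmax⟩ := isCompact_Icc.exists_isMaxOn (nonempty_Icc.2 ht.1)
        (hφ.mono (Icc_subset_Icc_right ht.2.le))
      have hrT : r ∈ Ico 0 T := ⟨hr.1, hr.2.trans_lt ht.2⟩
      have hrT' : r ∈ Icc 0 T := ⟨hrT.1, hrT.2.le⟩
      suffices hr0 : φ r = 0 from
        le_antisymm ((hrmax ⟨ht.1, le_rfl⟩).trans hr0.le) (hφ0 t ⟨ht.1, ht.2.le⟩)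
      rcases le_total r (n * (δ / 2)) with hrn | hrn
      · exact ih r hrT hrn
      set b := n * (δ / 2)
      have hb0 : 0 ≤ b := by positivity
      have hbT : b ∈ Icc 0 T := ⟨hb0, hrn.trans hrT'.2⟩
      have h0T : (0 : ℝ) ∈ Icc 0 T := ⟨le_rfl, hT.le⟩
      have h1 : ∫ s in 0..b, a s * φ s = 0 := by
        refine intervalIntegral.integral_zero_ae (.of_forall fun s hs => ?_)
        rw [uIoc_of_le hb0] at hs
        rw [ih s ⟨hs.1.le, hs.2.trans_lt (hrn.trans_lt hrT.2)⟩ hs.2, mul_zero]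
      have h2 : ∫ s in b..r, a s * φ s ≤ (∫ s in b..r, a s) * φ r := by
        rw [← intervalIntegral.integral_mul_const]
        refine intervalIntegral.integral_mono_on hrn (haφ b hbT r hrT')
          ((hai b hbT r hrT').mul_const _) fun s hs => ?_
        exact mul_le_mul_of_nonneg_left (hrmax ⟨hb0.trans hs.1, hs.2.trans hr.2⟩) (ha0 s)
      have h3 : ∫ s in b..r, a s ≤ 1 / 2 := by
        have hd : dist r b < δ := by
          rw [Real.dist_eq, abs_of_nonneg (by linarith)]
          have h4 : t ≤ b + δ / 2 := by
            refine htn.trans_eq ?_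
            push_cast
            ring
          linarith [hr.2]
        have := hδA r hrT' b hbT hd
        rw [Real.dist_eq, intervalIntegral.integral_interval_sub_left (hai 0 h0T r hrT')
          (hai 0 h0T b hbT)] at this
        exact ((le_abs_self _).trans_lt this).le
      have h5 := h r hrT
      rw [← intervalIntegral.integral_add_adjacent_intervals (haφ 0 h0T b hbT)
        (haφ b hbT r hrT'), h1, zero_add] at h5
      have h6 := hφ0 r hrT'
      nlinarith [mul_le_mul_of_nonneg_right h3 h6]
  have hIco : ∀ t ∈ Ico 0 T, φ t = 0 := fun t ht => by
    obtain ⟨n, hn⟩ := exists_nat_gt (t / (δ / 2))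
    exact key n t ht (by rw [div_lt_iff₀ (by positivity)] at hn; exact hn.le)
  have hcl : closure (Ico 0 T) = Icc 0 T := closure_Ico hT.ne
  intro t ht
  exact (show EqOn φ 0 (Icc 0 T) from
    Set.EqOn.of_subset_closure (s := Ico 0 T) (t := Icc 0 T) (g := 0) hIco hφ
      continuousOn_const Ico_subset_Icc_self hcl.ge) ht

/-! ### Pointwise inequalities for the nonlinearities. -/

/-- For `0 < b < a`, `b log (a/b) ≤ a - b` gives `a log a - b log b ≤ (a - b)(1 + log a)`. For
opposite signs `a - b = |a| + |b|` and each logarithm is bounded separately. Other cases follow by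
swapping or changing signs. -/
theorem mul_log_abs_sub_mul_sub_le (a b : ℝ) :
    (a * Real.log |a| - b * Real.log |b|) * (a - b) ≤
      (a - b) ^ 2 * (1 + Real.log (max 1 (|a| + |b|))) := by
  have hpos : ∀ a b : ℝ, 0 ≤ b → b ≤ a →
      (a * Real.log |a| - b * Real.log |b|) * (a - b) ≤
        (a - b) ^ 2 * (1 + Real.log (max 1 (|a| + |b|))) := by
    intro a b hb hab
    rcases hab.eq_or_lt with rfl | hab'
    · simp
    have ha : 0 < a := hb.trans_lt hab'
    have hN : Real.log a ≤ Real.log (max 1 (|a| + |b|)) :=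
      Real.log_le_log ha ((le_abs_self a).trans
        ((le_add_of_nonneg_right (abs_nonneg b)).trans (le_max_right _ _)))
    have h1 : a * Real.log |a| - b * Real.log |b| ≤ (a - b) * (1 + Real.log a) := by
      rw [abs_of_pos ha, abs_of_nonneg hb]
      rcases hb.eq_or_lt with rfl | hb'
      · simp only [zero_mul, sub_zero]; nlinarith
      have h2 := Real.log_le_sub_one_of_pos (div_pos ha hb')
      rw [Real.log_div ha.ne' hb'.ne'] at h2
      have h3 := mul_le_mul_of_nonneg_left h2 hb
      have h4 : b * (a / b - 1) = a - b := by field_simp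
      linarith
    calc _ ≤ (a - b) * (1 + Real.log a) * (a - b) := by
          exact mul_le_mul_of_nonneg_right h1 (by linarith)
      _ = (a - b) ^ 2 * (1 + Real.log a) := by ring
      _ ≤ _ := by gcongr
  have hle : ∀ a b : ℝ, b ≤ a →
      (a * Real.log |a| - b * Real.log |b|) * (a - b) ≤
        (a - b) ^ 2 * (1 + Real.log (max 1 (|a| + |b|))) := by
    intro a b hab
    rcases le_total 0 b with hb | hb
    · exact hpos a b hb hab
    rcases le_total a 0 with ha | ha
    · have := hpos (-b) (-a) (by linarith) (by linarith)
      rw [abs_neg, abs_neg, add_comm |b|] at this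
      convert this using 1 <;> ring
    · have hlog : ∀ x : ℝ, |x| ≤ |a| + |b| →
          |x| * Real.log |x| ≤ |x| * Real.log (max 1 (|a| + |b|)) := by
        intro x hx
        rcases (abs_nonneg x).eq_or_lt with h0 | h0
        · simp [← h0]
        · exact mul_le_mul_of_nonneg_left
            (Real.log_le_log h0 (hx.trans (le_max_right _ _))) h0.le
      have h1 := hlog a (le_add_of_nonneg_right (abs_nonneg b))
      have h2 := hlog b (le_add_of_nonneg_left (abs_nonneg a))
      rw [abs_of_nonneg ha, abs_of_nonpos hb] at h1 h2 ⊢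
      nlinarith [mul_le_mul_of_nonneg_right (add_le_add h1 h2) (sub_nonneg.2 hab),
        sq_nonneg (a - b)]
  rcases le_total b a with hab | hab
  · exact hle a b hab
  · have := hle b a hab
    rw [add_comm |b|] at this
    convert this using 1 <;> ring

theorem abs_mul_log_abs_le (x : ℝ) :
    |x * Real.log (|x|)| ≤ 1 + |x| * (1 + Real.log (max 1 |x|)) := by
  rcases eq_or_ne x 0 with rfl | hx
  · simp
  have hx0 : 0 < |x| := abs_pos.2 hx
  rcases le_total |x| 1 with h | h
  · have h1 := (Real.abs_log_mul_self_lt |x| hx0 h).le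
    rw [mul_comm, abs_mul, abs_abs] at h1
    rw [abs_mul, max_eq_left h, Real.log_one]
    linarith
  · rw [abs_mul, abs_of_nonneg (Real.log_nonneg h), max_eq_right h]
    nlinarith

theorem sqrt_log_max_le {x y : ℝ} (hxy : x ≤ y) :
    √(Real.log (max 1 x)) ≤ 1 + Real.log (max 1 y) := by
  have h0 : 0 ≤ Real.log (max 1 x) := Real.log_nonneg (le_max_left _ _)
  have h1 : Real.log (max 1 x) ≤ Real.log (max 1 y) :=
    Real.log_le_log (by positivity) (max_le_max le_rfl hxy)
  rw [Real.sqrt_le_left (by linarith)]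
  nlinarith

namespace LogHeat

/-- The square root can be given up, by `√t ≤ 1 + t`: the weighted estimate also controls the
squared logarithm that Young's inequality then produces. -/
theorem HypH.exists_abs_sub_le {σ : ℝ → ℝ} (hσ : HypH σ) :
    ∃ L : ℝ, 0 ≤ L ∧ ∀ x y : ℝ,
      |σ x - σ y| ≤ L * (|x - y| * (1 + Real.log (max 1 (|x| + |y|)))) := by
  obtain ⟨L₁, L₂, h1, h2, h⟩ := hσ
  refine ⟨L₁ + L₂, by positivity, fun x y => (h x y).trans ?_⟩
  have h3 := sqrt_log_max_le (max_le_add_of_nonneg (abs_nonneg x) (abs_nonneg y))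
  have h4 : 0 ≤ Real.log (max 1 (|x| + |y|)) := Real.log_nonneg (le_max_left _ _)
  have h5 := mul_le_mul_of_nonneg_left h3 (mul_nonneg h2.le (abs_nonneg (x - y)))
  nlinarith [mul_nonneg h1.le (mul_nonneg (abs_nonneg (x - y)) h4)]

theorem HypH.exists_abs_le {σ : ℝ → ℝ} (hσ : HypH σ) :
    ∃ c : ℝ, 0 ≤ c ∧ ∀ x : ℝ, |σ x| ≤ c * (1 + |x| * (1 + Real.log (max 1 |x|))) := by
  obtain ⟨L, hL, h⟩ := hσ.exists_abs_sub_le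
  refine ⟨|σ 0| + L, by positivity, fun x => ?_⟩
  have h1 := h x 0
  rw [sub_zero, abs_zero, add_zero] at h1
  have h2 := abs_sub_abs_le_abs_sub (σ x) (σ 0)
  have h3 : 0 ≤ Real.log (max 1 |x|) := Real.log_nonneg (le_max_left _ _)
  have h4 : 0 ≤ |x| * (1 + Real.log (max 1 |x|)) := by positivity
  nlinarith [mul_nonneg (abs_nonneg (σ 0)) h4]

end LogHeat

/-! ### Bounds for the functionals on `V`. -/

theorem integrable_sq_of_Lp {α : Type*} [MeasurableSpace α] {μ : Measure α} (f : Lp ℝ 2 μ) :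
    Integrable (fun x => f x ^ 2) μ ∧ ∫ x, f x ^ 2 ∂μ = ‖f‖ ^ 2 := by
  refine ⟨(Lp.memLp f).integrable_sq, ?_⟩
  rw [← real_inner_self_eq_norm_sq, L2.inner_def]
  simp [sq]

namespace LogHeat

variable {d : ℕ} {D : Opens (EuclideanSpace ℝ (Fin d))}

/-- Young gives `(1 + |u|ℓ)|v| ≤ 1 + v² + u² + v²ℓ²`, and the weighted estimate bounds the last term
for unit `v`. This makes the nonlinear terms bounded in `V*` along a solution. -/
theorem exists_norm_le_of_represents (hd : 0 < d)
    (hD : Bornology.IsBounded (D : Set (EuclideanSpace ℝ (Fin d)))) {R : ℝ} (hR : 0 ≤ R) :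
    ∃ C : ℝ, 0 ≤ C ∧ ∀ (g : ℝ → ℝ) (c : ℝ), 0 ≤ c →
      (∀ x, |g x| ≤ c * (1 + |x| * (1 + Real.log (max 1 |x|)))) →
      ∀ (u : H D) (F : StrongDual ℝ (V D)), ‖u‖ ≤ R → Represents D (fun x => g (u x)) F →
        ‖F‖ ≤ c * C := by
  obtain ⟨K, hK0, hK⟩ := exists_integral_incl_sq_mul_log_sq_le hd D hR
  have hfin : volume (D : Set (EuclideanSpace ℝ (Fin d))) ≠ ∞ := hD.measure_lt_top.ne
  set A := volume.real (D : Set (EuclideanSpace ℝ (Fin d)))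
  refine ⟨A + 1 + R ^ 2 + (2 + K), by positivity, fun g c hc hg u F hu hF => ?_⟩
  refine ContinuousLinearMap.opNorm_le_of_unit_norm (by positivity) fun v hv => ?_
  have hvn := norm_incl_sq_add v
  rw [hv] at hvn
  have hi1 : ‖incl D v‖ ≤ 1 := by nlinarith [norm_nonneg (incl D v), sq_nonneg ‖grad D v‖]
  have hg1 : ‖grad D v‖ ≤ 1 := by nlinarith [norm_nonneg (grad D v), sq_nonneg ‖incl D v‖]
  obtain ⟨hFi, hFv⟩ := hF v
  obtain ⟨hKi, hKv⟩ := hK v u hu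
  obtain ⟨hui, huv⟩ := integrable_sq_of_Lp u
  obtain ⟨hvi, hvv⟩ := integrable_sq_of_Lp (incl D v)
  have hone : IntegrableOn (fun _ => (1 : ℝ)) (D : Set (EuclideanSpace ℝ (Fin d))) :=
    integrableOn_const hfin
  have hpt : ∀ x, ‖g (u x) * incl D v x‖ ≤ c * (1 + incl D v x ^ 2 +
      (u x ^ 2 + incl D v x ^ 2 * (1 + Real.log (max 1 |u x|)) ^ 2)) := by
    intro x
    have h0 : 0 ≤ Real.log (max 1 |u x|) := Real.log_nonneg (le_max_left _ _)
    rw [norm_mul, Real.norm_eq_abs, Real.norm_eq_abs]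
    refine (mul_le_mul_of_nonneg_right (hg (u x)) (abs_nonneg _)).trans ?_
    rw [mul_assoc]
    refine mul_le_mul_of_nonneg_left ?_ hc
    rw [← sq_abs (incl D v x), ← sq_abs (u x)]
    nlinarith [sq_nonneg (|u x| - |incl D v x| * (1 + Real.log (max 1 |u x|))),
      sq_nonneg (|incl D v x| - 1), sq_nonneg |u x|,
      sq_nonneg (|incl D v x| * (1 + Real.log (max 1 |u x|))), sq_nonneg |incl D v x|]
  have hint := ((hone.integrable.fun_add hvi).fun_add (hui.fun_add hKi)).const_mul c
  rw [hFv]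
  calc ‖∫ x in (D : Set (EuclideanSpace ℝ (Fin d))), g (u x) * incl D v x‖
      ≤ ∫ x in (D : Set (EuclideanSpace ℝ (Fin d))), c * (1 + incl D v x ^ 2 +
          (u x ^ 2 + incl D v x ^ 2 * (1 + Real.log (max 1 |u x|)) ^ 2)) :=
        norm_integral_le_of_norm_le hint (.of_forall hpt)
    _ = c * (A + ‖incl D v‖ ^ 2 + (‖u‖ ^ 2 + ∫ x in (D : Set (EuclideanSpace ℝ (Fin d))),
          incl D v x ^ 2 * (1 + Real.log (max 1 |u x|)) ^ 2)) := by
        rw [integral_const_mul, integral_add (hone.integrable.fun_add hvi) (hui.fun_add hKi),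
          integral_add hone hvi, integral_add hui hKi, huv, hvv]
        simp [A]
    _ ≤ c * (A + 1 + R ^ 2 + (2 + K)) := by
        have h2 : ‖u‖ ^ 2 ≤ R ^ 2 := by gcongr
        have h3 : ‖incl D v‖ ^ 2 ≤ 1 := pow_le_one₀ (norm_nonneg _) hi1
        have h4 : K * (‖incl D v‖ * ‖grad D v‖) ≤ K :=
          mul_le_of_le_one_right hK0 (mul_le_one₀ hi1 (norm_nonneg _) hg1)
        refine mul_le_mul_of_nonneg_left ?_ hc
        linarith

theorem nonlinear_sub_mul_sub_le {σ : ℝ → ℝ} {L : ℝ}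
    (hLσ : ∀ x y : ℝ, |σ x - σ y| ≤ L * (|x - y| * (1 + Real.log (max 1 (|x| + |y|)))))
    (a b h : ℝ) :
    a * Real.log |a| * (a - b) - b * Real.log |b| * (a - b) +
        h * (σ a * (a - b) - σ b * (a - b)) ≤
      3 / 2 * ((a - b) ^ 2 * (1 + Real.log (max 1 (|a| + |b|))) ^ 2) +
        h ^ 2 * L ^ 2 / 2 * (a - b) ^ 2 := by
  have e1 := mul_log_abs_sub_mul_sub_le a b
  have e2 := hLσ a b
  have hℓ0 : 0 ≤ Real.log (max 1 (|a| + |b|)) := Real.log_nonneg (le_max_left _ _)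
  set ℓ := 1 + Real.log (max 1 (|a| + |b|))
  have hℓ : 1 ≤ ℓ := le_add_of_nonneg_right hℓ0
  have e3 : h * ((σ a - σ b) * (a - b)) ≤ |h| * (L * ((a - b) ^ 2 * ℓ)) := by
    refine (le_abs_self _).trans ?_
    rw [abs_mul, abs_mul]
    refine mul_le_mul_of_nonneg_left ?_ (abs_nonneg h)
    refine (mul_le_mul_of_nonneg_right e2 (abs_nonneg _)).trans_eq ?_
    rw [← sq_abs (a - b)]
    ring
  have e4 : |h| * (L * ((a - b) ^ 2 * ℓ)) ≤ (a - b) ^ 2 * (h ^ 2 * L ^ 2 / 2 + ℓ ^ 2 / 2) := by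
    have h1 : |h| * (L * ((a - b) ^ 2 * ℓ)) = (a - b) ^ 2 * (|h| * L * ℓ) := by ring
    rw [h1, ← sq_abs h]
    refine mul_le_mul_of_nonneg_left ?_ (sq_nonneg _)
    linarith [sq_nonneg (|h| * L - ℓ), mul_pow |h| L 2, sub_sq (|h| * L) ℓ]
  have e5 : (a - b) ^ 2 * ℓ ≤ (a - b) ^ 2 * ℓ ^ 2 :=
    mul_le_mul_of_nonneg_left (le_self_pow₀ hℓ two_ne_zero) (sq_nonneg _)
  linarith

theorem exists_two_mul_rate_sub_le (hd : 0 < d) {σ : ℝ → ℝ} (hσ : HypH σ) {R : ℝ} (hR : 0 ≤ R) :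
    ∃ C : ℝ, 0 ≤ C ∧ ∀ (w₁ w₂ : V D) (F₁ F₂ G₁ G₂ : StrongDual ℝ (V D)) (h : ℝ),
      ‖incl D w₁‖ ≤ R → ‖incl D w₂‖ ≤ R →
      Represents D (fun x => incl D w₁ x * Real.log |incl D w₁ x|) F₁ →
      Represents D (fun x => incl D w₂ x * Real.log |incl D w₂ x|) F₂ →
      Represents D (fun x => σ (incl D w₁ x)) G₁ → Represents D (fun x => σ (incl D w₂ x)) G₂ →
      2 * (laplacian D w₁ + F₁ + h • G₁ - (laplacian D w₂ + F₂ + h • G₂)) (w₁ - w₂) ≤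
        C * (1 + h ^ 2) * ‖incl D w₁ - incl D w₂‖ ^ 2 := by
  obtain ⟨L, hL, hLσ⟩ := hσ.exists_abs_sub_le
  obtain ⟨K, hK0, hK⟩ := exists_integral_incl_sq_mul_log_sq_le hd D (R := R + R) (by positivity)
  refine ⟨6 + 2 * K ^ 2 + L ^ 2, by positivity,
    fun w₁ w₂ F₁ F₂ G₁ G₂ h hw₁ hw₂ hF₁ hF₂ hG₁ hG₂ => ?_⟩
  set u := incl D w₁ with hu
  set v := incl D w₂ with hv
  set w := w₁ - w₂ with hw
  have hiw : incl D w = u - v := map_sub _ _ _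
  -- One function in `H`, of norm at most `2R`, dominates both arguments of the logarithm.
  set m : H D := |u| + |v| with hm
  have hmR : ‖m‖ ≤ R + R := by
    refine (norm_add_le _ _).trans ?_
    rw [norm_abs_eq_norm, norm_abs_eq_norm]
    exact add_le_add hw₁ hw₂
  obtain ⟨hKi, hKv⟩ := hK w m hmR
  obtain ⟨hwi, hwv⟩ := integrable_sq_of_Lp (incl D w)
  obtain ⟨hF₁i, hF₁v⟩ := hF₁ w
  obtain ⟨hF₂i, hF₂v⟩ := hF₂ w
  obtain ⟨hG₁i, hG₁v⟩ := hG₁ w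
  obtain ⟨hG₂i, hG₂v⟩ := hG₂ w
  have fsub : ∀ {f g : EuclideanSpace ℝ (Fin d) → ℝ},
      IntegrableOn f (D : Set (EuclideanSpace ℝ (Fin d))) →
      IntegrableOn g (D : Set (EuclideanSpace ℝ (Fin d))) →
      Integrable (fun x => f x - g x) (volume.restrict (D : Set (EuclideanSpace ℝ (Fin d)))) :=
    fun hf hg => hf.sub hg
  have hlap : laplacian D w₁ w - laplacian D w₂ w = -‖grad D w‖ ^ 2 := by
    change -⟪grad D w₁, grad D w⟫ - -⟪grad D w₂, grad D w⟫ = _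
    rw [← real_inner_self_eq_norm_sq]
    nth_rewrite 3 [hw]
    rw [map_sub, inner_sub_left]
    ring
  have hexp : (laplacian D w₁ + F₁ + h • G₁ - (laplacian D w₂ + F₂ + h • G₂)) w =
      -‖grad D w‖ ^ 2 + ((F₁ w - F₂ w) + h * (G₁ w - G₂ w)) := by
    rw [← hlap]
    simp only [sub_apply, add_apply, smul_apply, smul_eq_mul]
    ring
  have hnl : (F₁ w - F₂ w) + h * (G₁ w - G₂ w) ≤
      3 / 2 * (2 * ‖incl D w‖ ^ 2 + K * (‖incl D w‖ * ‖grad D w‖)) +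
        h ^ 2 * L ^ 2 / 2 * ‖incl D w‖ ^ 2 := by
    rw [hF₁v, hF₂v, hG₁v, hG₂v, ← integral_sub hF₁i hF₂i, ← integral_sub hG₁i hG₂i,
      ← integral_const_mul, ← integral_add (fsub hF₁i hF₂i) ((fsub hG₁i hG₂i).const_mul h)]
    refine le_trans ?_ (add_le_add (mul_le_mul_of_nonneg_left hKv (by norm_num)) le_rfl)
    rw [← hwv, ← integral_const_mul, ← integral_const_mul,
      ← integral_add (hKi.const_mul _) (hwi.const_mul _)]
    refine integral_mono_ae ((fsub hF₁i hF₂i).fun_add ((fsub hG₁i hG₂i).const_mul h))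
      ((hKi.const_mul _).fun_add (hwi.const_mul _)) ?_
    filter_upwards [Lp.coeFn_sub u v, Lp.coeFn_add |u| |v|, Lp.coeFn_abs u, Lp.coeFn_abs v]
      with x h1 h2 h3 h4
    have hwx : incl D w x = u x - v x := by rw [hiw, h1, Pi.sub_apply]
    have hmx : |m x| = |u x| + |v x| := by
      rw [hm, h2, Pi.add_apply, h3, h4, abs_of_nonneg (by positivity)]
    have := nonlinear_sub_mul_sub_le hLσ (u x) (v x) h
    rw [← hmx, ← hwx] at this
    exact this
  rw [hexp, ← hiw]
  -- The factor 3 is `2 · 3/2`; the gradient part is exactly what `-2‖∇w‖²` cancels.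
  have e6 : K * (‖incl D w‖ * ‖grad D w‖) * 3 ≤ 2 * ‖grad D w‖ ^ 2 + 2 * K ^ 2 * ‖incl D w‖ ^ 2 := by
    nlinarith [sq_nonneg (3 * K * ‖incl D w‖ - 4 * ‖grad D w‖), sq_nonneg (K * ‖incl D w‖)]
  have e7 : 0 ≤ (6 + 2 * K ^ 2) * h ^ 2 * ‖incl D w‖ ^ 2 + L ^ 2 * ‖incl D w‖ ^ 2 := by positivity
  nlinarith

end LogHeat

/-! ### Square integrability in time and conclusion. -/

theorem memLp_fun_add {α E : Type*} [MeasurableSpace α] {μ : Measure α} [NormedAddCommGroup E]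
    {p : ℝ≥0∞} {f g : α → E} (hf : MemLp f p μ) (hg : MemLp g p μ) :
    MemLp (fun x => f x + g x) p μ :=
  hf.add hg

namespace LogHeat

variable {d : ℕ} {D : Opens (EuclideanSpace ℝ (Fin d))}

theorem norm_grad_le (v : V D) : ‖grad D v‖ ≤ ‖v‖ :=
  (sq_le_sq₀ (norm_nonneg _) (norm_nonneg _)).1
    (by linarith [norm_incl_sq_add v, sq_nonneg ‖incl D v‖])

theorem norm_laplacian_le (v : V D) : ‖laplacian D v‖ ≤ ‖v‖ := by
  refine ContinuousLinearMap.opNorm_le_bound _ (norm_nonneg _) fun x => ?_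
  change ‖-⟪grad D v, grad D x⟫‖ ≤ _
  rw [norm_neg]
  exact (norm_inner_le_norm _ _).trans (by gcongr <;> exact norm_grad_le _)

theorem continuous_laplacian : Continuous (laplacian D) := by
  unfold laplacian
  exact (((ContinuousLinearMap.precomp ℝ (grad D)).continuous).comp
    ((innerSL ℝ).continuous.comp (grad D).continuous)).neg

/-- A solution only has integrable nonlinear terms, while the energy equality needs `L²` in time
with values in `V*`. Continuity in `H` bounds `‖u‖` on `[0,T]`, hence `F` and `G` in `V*`, and `h ∈
L²` does the rest. -/
theorem IsSkeletonSolution.exists_rate (hd : 0 < d)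
    (hD : Bornology.IsBounded (D : Set (EuclideanSpace ℝ (Fin d)))) {σ : ℝ → ℝ} (hσ : HypH σ)
    {T : ℝ} {h : ℝ → ℝ} (hh : MemLp h 2 (volume.restrict (Icc 0 T))) {u₀ : H D} {u : ℝ → H D}
    (hu : IsSkeletonSolution D σ T h u₀ u) :
    ∃ (w : ℝ → V D) (Φ : ℝ → StrongDual ℝ (V D)),
      MemLp w 2 (volume.restrict (Icc 0 T)) ∧ MemLp Φ 2 (volume.restrict (Icc 0 T)) ∧
      (∀ᵐ s ∂(volume.restrict (Icc 0 T)), incl D (w s) = u s) ∧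
      (∀ᵐ s ∂(volume.restrict (Icc 0 T)), ∃ F G : StrongDual ℝ (V D),
        Represents D (fun x => incl D (w s) x * Real.log |incl D (w s) x|) F ∧
        Represents D (fun x => σ (incl D (w s) x)) G ∧
        Φ s = laplacian D (w s) + F + h s • G) ∧
      ∀ t ∈ Icc 0 T, toVDual D (u t) = toVDual D u₀ + ∫ s in 0..t, Φ s := by
  obtain ⟨w, F, G, hw, hwu, hF, hG, hFi, hGi, heq⟩ := hu.equation
  obtain ⟨R, hR⟩ := isCompact_Icc.exists_bound_of_continuousOn hu.continuousOn
  obtain ⟨C, hC0, hC⟩ := exists_norm_le_of_represents hd hD (le_max_right R 0)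
  obtain ⟨c, hc0, hc⟩ := hσ.exists_abs_le
  have hR' : ∀ᵐ s ∂(volume.restrict (Icc 0 T)), ‖u s‖ ≤ max R 0 := by
    filter_upwards [ae_restrict_mem measurableSet_Icc] with s hs
    exact (hR s hs).trans (le_max_left _ _)
  have hL2 : MemLp (fun s => laplacian D (w s)) 2 (volume.restrict (Icc 0 T)) :=
    hw.of_le (continuous_laplacian.comp_aestronglyMeasurable hw.1)
      (.of_forall fun s => norm_laplacian_le _)
  have hF2 : MemLp F 2 (volume.restrict (Icc 0 T)) := by
    refine MemLp.of_bound hFi.aestronglyMeasurable (1 * C) ?_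
    filter_upwards [hF, hR'] with s hs hsR
    exact hC (fun x => x * Real.log |x|) 1 zero_le_one
      (fun x => by rw [one_mul]; exact abs_mul_log_abs_le x) _ _ hsR hs
  have hG2 : MemLp (fun s => h s • G s) 2 (volume.restrict (Icc 0 T)) := by
    refine hh.of_le_mul (c := c * C) hGi.aestronglyMeasurable ?_
    filter_upwards [hG, hR'] with s hs hsR
    rw [norm_smul, mul_comm]
    exact mul_le_mul_of_nonneg_right (hC σ c hc0 hc _ _ hsR hs) (norm_nonneg _)
  have hΦ : MemLp (fun s => laplacian D (w s) + F s + h s • G s) 2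
      (volume.restrict (Icc 0 T)) := memLp_fun_add (memLp_fun_add hL2 hF2) hG2
  refine ⟨w, fun s => laplacian D (w s) + F s + h s • G s, hw, hΦ, hwu, ?_,
    fun t ht => ?_⟩
  · filter_upwards [hwu, hF, hG] with s hs hsF hsG
    exact ⟨F s, G s, by rwa [hs], by rwa [hs], rfl⟩
  · have hint : ∀ {f : ℝ → StrongDual ℝ (V D)}, MemLp f 2 (volume.restrict (Icc 0 T)) →
        IntervalIntegrable f volume 0 t := fun hf =>
      intervalIntegrable_iff.2 (IntegrableOn.mono_set (hf.integrable one_le_two)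
        (by rw [uIoc_of_le ht.1]
            exact Ioc_subset_Icc_self.trans (Icc_subset_Icc_right ht.2)))
    rw [heq t ht, intervalIntegral.integral_add ((hint hL2).add (hint hF2)) (hint hG2),
      intervalIntegral.integral_add (hint hL2) (hint hF2), add_assoc, add_assoc, add_assoc]

end LogHeat

theorem mainTheorem3 {d : ℕ} (hd : 0 < d) (D : Opens (EuclideanSpace ℝ (Fin d)))
    (hD : Bornology.IsBounded (D : Set (EuclideanSpace ℝ (Fin d))))
    (σ : ℝ → ℝ) (hσ : LogHeat.HypH σ)
    (T : ℝ) (hT : 0 < T)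
    (h : ℝ → ℝ) (hh : MemLp h 2 (volume.restrict (Icc 0 T)))
    (u₀ : LogHeat.H D) (u v : ℝ → LogHeat.H D)
    (hu : LogHeat.IsSkeletonSolution D σ T h u₀ u)
    (hv : LogHeat.IsSkeletonSolution D σ T h u₀ v) :
    ∀ t ∈ Icc (0 : ℝ) T, u t = v t := by
  obtain ⟨w₁, Φ₁, hw₁, hΦ₁, hwu, hrep₁, heq₁⟩ := hu.exists_rate hd hD hσ hh
  obtain ⟨w₂, Φ₂, hw₂, hΦ₂, hwv, hrep₂, heq₂⟩ := hv.exists_rate hd hD hσ hh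
  obtain ⟨R₁, hR₁⟩ := isCompact_Icc.exists_bound_of_continuousOn hu.continuousOn
  obtain ⟨R₂, hR₂⟩ := isCompact_Icc.exists_bound_of_continuousOn hv.continuousOn
  obtain ⟨C, hC0, hC⟩ := LogHeat.exists_two_mul_rate_sub_le (D := D) hd hσ
    (le_max_right (max R₁ R₂) 0)
  -- The Riesz isomorphism turns the duality pairing into the inner product of `V`, the form used by
  -- the energy equality.
  let e := (InnerProductSpace.toDual ℝ (LogHeat.V D)).symm
  set ψ : ℝ → LogHeat.V D := fun s => e (Φ₁ s - Φ₂ s) with hψ_def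
  have hψe : ∀ s x, ⟪ψ s, x⟫ = (Φ₁ s - Φ₂ s) x := fun s x =>
    InnerProductSpace.toDual_symm_apply
  have hΦ : MemLp (fun s => Φ₁ s - Φ₂ s) 2 (volume.restrict (Icc 0 T)) := hΦ₁.sub hΦ₂
  have hψ : MemLp ψ 2 (volume.restrict (Icc 0 T)) :=
    hΦ.of_le (e.continuous.comp_aestronglyMeasurable hΦ.1)
      (.of_forall fun s => (e.norm_map _).le)
  have hw : MemLp (fun s => w₁ s - w₂ s) 2 (volume.restrict (Icc 0 T)) := hw₁.sub hw₂
  have hint : ∀ t ∈ Icc 0 T, ∀ {E : Type} [NormedAddCommGroup E] {f : ℝ → E},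
      IntegrableOn f (Icc 0 T) → IntervalIntegrable f volume 0 t := fun t ht _ _ _ hf =>
    intervalIntegrable_iff.2 (hf.mono_set (by
      rw [uIoc_of_le ht.1]
      exact Ioc_subset_Icc_self.trans (Icc_subset_Icc_right ht.2)))
  have hcont : ContinuousOn (fun t => u t - v t) (Icc 0 T) := hu.continuousOn.sub hv.continuousOn
  have hincl : ∀ᵐ s ∂(volume.restrict (Icc 0 T)),
      LogHeat.incl D (w₁ s - w₂ s) = u s - v s := by
    filter_upwards [hwu, hwv] with s h1 h2
    rw [map_sub, h1, h2]
  have heq : ∀ t ∈ Icc 0 T, ∀ x,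
      ⟪u t - v t, LogHeat.incl D x⟫ = ∫ s in 0..t, ⟪ψ s, x⟫ := by
    intro t ht x
    simp only [hψe]
    rw [← ContinuousLinearMap.intervalIntegral_apply
        (hint t ht (hΦ.integrable one_le_two)),
      intervalIntegral.integral_sub (hint t ht (hΦ₁.integrable one_le_two))
        (hint t ht (hΦ₂.integrable one_le_two)),
      ← add_sub_add_left_eq_sub _ _ (LogHeat.toVDual D u₀), ← heq₁ t ht, ← heq₂ t ht,
      inner_sub_left]
    rfl
  have henergy := fun τ hτ => norm_sq_eq_two_mul_integral_inner (LogHeat.incl D) hcont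
    (by rw [hu.initial, hv.initial, sub_self]) hw hψ hincl heq (τ := τ) hτ
  -- The Gronwall coefficient is integrable because `h` is square integrable.
  have hh2 : IntegrableOn (fun s => C * (1 + h s ^ 2)) (Icc 0 T) :=
    ((integrable_const (1 : ℝ)).add hh.integrable_sq).const_mul C
  have hrate : ∀ᵐ s ∂(volume.restrict (Icc 0 T)),
      2 * ⟪ψ s, w₁ s - w₂ s⟫ ≤ C * (1 + h s ^ 2) * ‖u s - v s‖ ^ 2 := by
    filter_upwards [hwu, hwv, hrep₁, hrep₂, ae_restrict_mem measurableSet_Icc]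
      with s h1 h2 ⟨F₁, G₁, hF₁, hG₁, hs₁⟩ ⟨F₂, G₂, hF₂, hG₂, hs₂⟩ hs
    rw [hψe, hs₁, hs₂, ← h1, ← h2]
    refine hC _ _ _ _ _ _ _ ?_ ?_ hF₁ hF₂ hG₁ hG₂
    · rw [h1]
      exact (hR₁ s hs).trans ((le_max_left _ _).trans (le_max_left _ _))
    · rw [h2]
      exact (hR₂ s hs).trans ((le_max_right _ _).trans (le_max_left _ _))
  have hφ : ContinuousOn (fun t => ‖u t - v t‖ ^ 2) (Icc 0 T) := hcont.norm.pow 2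
  have hzero := eq_zero_of_le_intervalIntegral_mul (φ := fun t => ‖u t - v t‖ ^ 2) hT hφ
    (fun t _ => by positivity) hh2 (fun s => by positivity) fun τ hτ => ?_
  · intro t ht
    simpa [sub_eq_zero] using hzero t ht
  · have hτ' : τ ∈ Icc 0 T := ⟨hτ.1, hτ.2.le⟩
    simp only [henergy τ hτ, ← intervalIntegral.integral_const_mul]
    refine intervalIntegral.integral_mono_ae_restrict hτ.1
      ((hint τ hτ' (integrable_inner_of_memLp hψ hw)).const_mul 2)
      (hint τ hτ' (hh2.mul_continuousOn hφ isCompact_Icc)) ?_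
    exact ae_restrict_of_ae_restrict_of_subset (Icc_subset_Icc_right hτ.2.le) hrate
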